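/- Let $\Pi$ be an irreducible reduced crystallographic (finite) root system with a fixed set of simple roots $\Delta$, corresponding set of positive roots $\Pi_+$, and Weyl group $W$. For roots $\alpha,\beta$ write $\alpha\le\beta$ if $\beta-\alpha$ is a non-negative integer combination of simple roots. For $u\in W$ let $\Gamma(u)$ be the directed graph with vertex set $u(\Pi_+)\cap\Pi_+$ and an edge $\alpha\to\beta$ if and only if $u^{-1}(\alpha)\le\beta$ (loops are allowed); $u$ is called *rational* if $\Gamma(u)$ has no directed cycles (a loop counts as a cycle). The *rationality graph* $\Gamma(W)$ is the graph whose vertices are the rational elements of $W$, with $u$ and $v$ joined by an edge if and only if $u=s_\alpha v$ for some $\alpha\in\Delta$. A *Coxeter element* is a product of all simple reflections, each taken exactly once, in some order. Then a Coxeter element $c\in W$ is rational if and only if $\Pi$ is of type $A_r$ for some $r\ge 1$ and $c\in\{C,C^{-1}\}$, where $C=s_1s_2\cdots s_r$ and the simple roots are numbered in the standard way along the Dynkin diagram of type $A_r$. In this case, if $r\ge 2$, the element $c$ has valency $1$ in the rationality graph $\Gamma(W)=\Gamma(A_r)$. -/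

import Mathlib

namespace RatWeyl

open RootPairing

variable {ι K M N : Type*} [Field K] [AddCommGroup M] [Module K M]
  [AddCommGroup N] [Module K N] {P : RootPairing ι K M N}

/-- The reflection in the root with index `i`, as an element of the Weyl group; it is a simple
reflection when `i` lies in the support of the base. -/
abbrev refl (P : RootPairing ι K M N) (i : ι) : P.weylGroup := weylGroup.ofIdx P i

theorem refl_mul_self (i : ι) : refl P i * refl P i = 1 := by
  apply Subtype.ext
  change Equiv.reflection P i * Equiv.reflection P i = 1
  have h := Equiv.reflection_inv P i
  rw [inv_eq_iff_mul_eq_one] at h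
  exact h

variable [CharZero K]

/-- The set of (indices of) positive roots with respect to the base `b`. -/
def posRoots (b : P.Base) : Set ι := {i | b.IsPos i}

/-- The root order: `α ≤ β` iff `β - α` is a sum of simple roots
(a combination of simple roots with natural number coefficients). -/
def RootLE (b : P.Base) (i j : ι) : Prop :=
  P.root j - P.root i ∈ AddSubmonoid.closure (P.root '' b.support)

/-- The set of positive roots in the image under `u` of the set of positive roots. -/
def nuZero (b : P.Base) (u : P.weylGroup) : Set ι :=
  (fun i => u • i) '' posRoots b ∩ posRoots b

/-- The oriented graph attached to a Weyl group element `u`: its vertices are the roots in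
`nuZero b u`, and there is an edge `α → β` iff `u⁻¹ α ≤ β`. Loops are allowed. -/
def elementGraph (b : P.Base) (u : P.weylGroup) : Digraph (nuZero b u) where
  Adj α β := RootLE b (u⁻¹ • (α : ι)) (β : ι)

/-- A Weyl group element is rational if its oriented graph has no cycles, that is, no closed
directed paths of positive length (a loop is a cycle). -/
def IsRational (b : P.Base) (u : P.weylGroup) : Prop :=
  ∀ α : nuZero b u, ¬ Relation.TransGen (elementGraph b u).Adj α α

/-- A Coxeter element: the product of all simple reflections, each taken once, in some order. -/
def IsCoxeterElement (b : P.Base) (c : P.weylGroup) : Prop :=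
  ∃ l : List ι, l.Nodup ∧ (∀ i, i ∈ l ↔ i ∈ b.support) ∧ c = (l.map (refl P)).prod

/-- `e` is a standard numbering of the simple roots of a root system of type `A_r`. -/
def IsTypeANumbering [P.IsCrystallographic] (b : P.Base) {r : ℕ} (e : Fin r ≃ b.support) : Prop :=
  ∀ i j, b.cartanMatrix (e i) (e j) = CartanMatrix.A r i j

/-- The product `s₁ s₂ ⋯ s_r` of the simple reflections in the order of the numbering `e`. -/
noncomputable def specialCoxeter (b : P.Base) {r : ℕ} (e : Fin r ≃ b.support) : P.weylGroup :=
  (List.ofFn fun k : Fin r => refl P (e k)).prod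

theorem refl_ne_one (i : ι) : refl P i ≠ 1 := by
  intro h
  have h1 : refl P i • P.root i = P.root i := by rw [h, one_smul]
  have h2 : refl P i • P.root i = P.reflection i (P.root i) := rfl
  rw [h2, P.reflection_apply_self] at h1
  have h3 : (2 : K) • P.root i = 0 := by
    rw [two_smul]
    nth_rewrite 1 [← h1]
    simp
  exact P.ne_zero i ((smul_eq_zero.mp h3).resolve_left two_ne_zero)

/-- The rationality graph of the Weyl group: the vertices are the rational elements, and `u`, `v`
are joined by an edge iff `u = s v` for some simple reflection `s`. -/
def rationalityGraph (b : P.Base) : SimpleGraph {u : P.weylGroup // IsRational b u} where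
  Adj u v := ∃ i ∈ b.support, (u : P.weylGroup) = refl P i * v
  symm := ⟨by
    rintro u v ⟨i, hi, h⟩
    exact ⟨i, hi, by rw [h, ← mul_assoc, refl_mul_self, one_mul]⟩⟩
  loopless := ⟨by
    rintro u ⟨i, -, h⟩
    exact refl_ne_one i (mul_eq_right.mp h.symm)⟩

end RatWeyl

/-!
Coordinates are taken with respect to the simple roots, numbered so that the Coxeter element is
`c = s₁ ⋯ s_r`; every Coxeter element has this form, as `specialCoxeter` allows any numbering. The
basic tool is `coeff_specialCoxeter_smul`: the coordinates `v` of a root and `w` of its image under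
`c` satisfy the triangular system `U w = -L v`, where `U + L` is the transposed Cartan matrix split
into its upper and lower unitriangular parts.

*Rational implies type `A`.* Let `γ` be a dominant root. Then `c⁻¹ γ ≤ γ`, so `c⁻¹ γ` must be
negative, since `γ` would carry a loop otherwise. As `γ` has full support, `s_{r-1} ⋯ s₁ γ` is still
positive, and thus `c⁻¹ γ = -α_r` (`IsRational.inv_smul_dominant`). Hence `-c α_r` is the only
dominant root. Every Weyl group orbit of roots contains a dominant one, so there is a single orbit,
all roots have the same length and the Cartan matrix is symmetric, with entries `0` and `-1` off the
diagonal. Orient the Dynkin diagram from smaller to larger index. The system for `γ = -c α_r` says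
that the coordinate of `γ` at a vertex other than the last is the sum over its out-neighbours, and
dominance says that it is at least the sum over its in-neighbours. As all coordinates are positive,
each vertex but the last has exactly one out-neighbour and at most one in-neighbour. If the last
vertex had two in-neighbours `p` and `q`, then `c α_p` and `c α_q` would form a cycle of length two
(`IsRational.in_neighbor_last_unique`). So the out-neighbour map is injective and raises the index;
it has to be `k ↦ k + 1`, which means that the numbering is a standard one of type `A_r`.

*Type `A`.* The triangular system says that `c` shifts coordinates to the right, up to a multiple of
the all-one vector, and this multiple vanishes when a positive root stays positive. Hence the
smallest index in the support decreases strictly along the edges of the graph of `c`, and there is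
no cycle. The inverse of `c` is the same element for the reversed numbering. The same argument shows
that `s_r c` is rational, whereas for `i < r` the element `s_i c` sends `γ = α_i + ⋯ + α_{r-1}` to
`γ + α_r`, which therefore carries a loop. So `s_r c` is the only neighbour of `c` in the
rationality graph.
-/

namespace RatWeyl

open RootPairing

/-! ### Integer coordinates with respect to the simple roots -/

section Coefficients

variable {ι K M N : Type*} [Field K] [CharZero K] [AddCommGroup M] [Module K M]
  [AddCommGroup N] [Module K N] {P : RootPairing ι K M N} (b : P.Base)

/-- The integer coordinates of the root with index `i` with respect to the simple roots. -/
noncomputable def coeff (i : ι) : b.support → ℤ :=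
  b.toWeightBasisInt.repr (P.rootSpanMem ℤ i)

theorem root_eq_sum_coeff (i : ι) : P.root i = ∑ k, coeff b i k • P.root k := by
  have h := congrArg Subtype.val (b.toWeightBasisInt.sum_repr (P.rootSpanMem ℤ i))
  simp only [AddSubmonoidClass.coe_finsetSum, Submodule.coe_smul,
    Base.coe_toWeightBasisInt_apply] at h
  exact h.symm

theorem eq_of_sum_root_eq {f g : b.support → ℤ}
    (h : ∑ k, f k • P.root k = ∑ k, g k • P.root k) : f = g :=
  funext (Fintype.linearIndependent_iffₛ.mp (b.linearIndepOn_root.restrict_scalars' ℤ) f g h)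

theorem coeff_eq_of_root_eq_sum {i : ι} {f : b.support → ℤ}
    (h : P.root i = ∑ k, f k • P.root k) : coeff b i = f :=
  eq_of_sum_root_eq b ((root_eq_sum_coeff b i).symm.trans h)

theorem coeff_simple [DecidableEq b.support] (k : b.support) :
    coeff b k = Pi.single k 1 :=
  coeff_eq_of_root_eq_sum b (by simp [Pi.single_apply])

theorem coeff_eq_neg {i j : ι} (h : P.root i = -P.root j) : coeff b i = -coeff b j :=
  coeff_eq_of_root_eq_sum b (by
    rw [h, root_eq_sum_coeff b j]
    simp)

theorem height_eq_sum_coeff (i : ι) : b.height i = ∑ k, coeff b i k := by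
  classical
  let f : ι → ℤ := fun j => if h : j ∈ b.support then coeff b i ⟨j, h⟩ else 0
  have hf : ∀ k : b.support, f k = coeff b i k := fun k => by simp [f]
  have h : P.root i = ∑ j ∈ b.support, f j • P.root j := by
    rw [root_eq_sum_coeff b i, ← Finset.sum_coe_sort b.support]
    simp [hf]
  rw [Base.height_eq_sum h, ← Finset.sum_coe_sort b.support]
  simp [hf]

theorem exists_coeff_ne_zero (i : ι) : ∃ k, coeff b i k ≠ 0 := by
  by_contra! h
  exact P.ne_zero i (by rw [root_eq_sum_coeff b i]; simp [h])

theorem coeff_nonneg_or_nonpos (i : ι) :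
    (∀ k, 0 ≤ coeff b i k) ∨ (∀ k, coeff b i k ≤ 0) := by
  obtain ⟨f, -, hf, h⟩ := b.exists_root_eq_sum_int i
  have hc : coeff b i = fun k : b.support => f k :=
    coeff_eq_of_root_eq_sum b (f := fun k : b.support => f k)
      (by rw [h, ← Finset.sum_coe_sort b.support])
  rw [hc]
  exact hf.imp (fun hf k => hf.le k) (fun hf k => hf.le k)

theorem isPos_iff_coeff_nonneg {i : ι} : b.IsPos i ↔ ∀ k, 0 ≤ coeff b i k := by
  refine ⟨fun h => (coeff_nonneg_or_nonpos b i).resolve_right fun h' => ?_, fun h => ?_⟩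
  · rw [Base.isPos_iff, height_eq_sum_coeff] at h
    exact absurd (Finset.sum_nonpos fun k _ => h' k) (not_le.mpr h)
  · rw [Base.isPos_iff', height_eq_sum_coeff]
    exact Finset.sum_nonneg fun k _ => h k

/-- A single positive coordinate already forces a root to be positive. -/
theorem isPos_of_coeff_pos {i : ι} {k : b.support} (h : 0 < coeff b i k) : b.IsPos i :=
  (isPos_iff_coeff_nonneg b).mpr
    ((coeff_nonneg_or_nonpos b i).resolve_right fun h' => absurd (h' k) (not_le.mpr h))

theorem rootLE_iff_coeff_le {i j : ι} :
    RootLE b i j ↔ ∀ k, coeff b i k ≤ coeff b j k := by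
  have key : ∀ f : b.support → ℤ,
      ∑ k, f k • P.root k ∈ AddSubmonoid.closure (P.root '' b.support) ↔ ∀ k, 0 ≤ f k := by
    intro f
    rw [← Submodule.span_nat_eq_addSubmonoidClosure, Submodule.mem_toAddSubmonoid,
      Fintype.mem_span_image_iff_exists_fun]
    constructor
    · rintro ⟨c, hc⟩ k
      have : (fun k => (c k : ℤ)) = f := eq_of_sum_root_eq b
        (hc ▸ Finset.sum_congr rfl fun k _ => natCast_zsmul _ _)
      simp [← this]
    · intro h
      refine ⟨fun k => (f k).toNat, Finset.sum_congr rfl fun k _ => ?_⟩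
      conv_rhs => rw [← Int.toNat_of_nonneg (h k), natCast_zsmul]
  have h : P.root j - P.root i = ∑ k, (coeff b j k - coeff b i k) • P.root k := by
    simp only [sub_smul, Finset.sum_sub_distrib, ← root_eq_sum_coeff]
  rw [RootLE, h, key]
  simp

end Coefficients

section Action

variable {ι K M N : Type*} [Field K] [AddCommGroup M] [Module K M]
  [AddCommGroup N] [Module K N] {P : RootPairing ι K M N}

theorem root_smul (u : P.weylGroup) (i : ι) : P.root (u • i) = u • P.root i :=
  (P.weylGroup_apply_root u i).symm

theorem refl_smul (k i : ι) : refl P k • i = P.reflectionPerm k i := rfl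

end Action

section Reflections

variable {ι K M N : Type*} [Field K] [CharZero K] [AddCommGroup M] [Module K M]
  [AddCommGroup N] [Module K N] {P : RootPairing ι K M N} [P.IsCrystallographic] (b : P.Base)

theorem pairingIn_eq_sum_coeff (i : ι) (k : b.support) :
    P.pairingIn ℤ i k = ∑ j, coeff b i j * b.cartanMatrix j k := by
  refine FaithfulSMul.algebraMap_injective ℤ K ?_
  simp_rw [map_sum, map_mul, Base.algebraMap_cartanMatrixIn_apply, algebraMap_pairingIn,
    ← P.root_coroot'_eq_pairing]
  conv_lhs => rw [root_eq_sum_coeff b i]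
  simp

open scoped Classical in
theorem coeff_refl_smul (k : b.support) (i : ι) (j : b.support) :
    coeff b (refl P k • i) j = coeff b i j - if j = k then P.pairingIn ℤ i k else 0 := by
  refine congrFun (coeff_eq_of_root_eq_sum b
    (f := fun j => coeff b i j - if j = k then P.pairingIn ℤ i k else 0) ?_) j
  rw [refl_smul, root_reflectionPerm, P.reflection_apply_root' ℤ]
  simp only [sub_smul, ite_smul, zero_smul, Finset.sum_sub_distrib, Finset.sum_ite_eq',
    Finset.mem_univ, if_true, ← root_eq_sum_coeff]

theorem coeff_refl_smul_self (k : b.support) (i : ι) :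
    coeff b (refl P k • i) k = coeff b i k - ∑ j, coeff b i j * b.cartanMatrix j k := by
  rw [coeff_refl_smul, if_pos rfl, pairingIn_eq_sum_coeff]

theorem coeff_refl_smul_of_ne {j k : b.support} (hjk : j ≠ k) (i : ι) :
    coeff b (refl P k • i) j = coeff b i j := by
  rw [coeff_refl_smul, if_neg hjk, sub_zero]

/-- A product of simple reflections only changes the coordinates at the reflections used. -/
theorem coeff_prod_refl_smul_of_notMem {j : b.support} (l : List b.support) (hj : j ∉ l) (i : ι) :
    coeff b ((l.map fun k : b.support => refl P k).prod • i) j = coeff b i j := by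
  induction l with
  | nil => simp
  | cons k l ih =>
    rw [List.mem_cons, not_or] at hj
    rw [List.map_cons, List.prod_cons, mul_smul, coeff_refl_smul_of_ne b hj.1, ih hj.2]

end Reflections

/-! ### Coxeter elements in coordinates -/

section Coxeter

variable {ι K M N : Type*} [Field K] [AddCommGroup M] [Module K M]
  [AddCommGroup N] [Module K N] {P : RootPairing ι K M N} (b : P.Base)

/-- Every Coxeter element is `s₁ ⋯ s_r` for some numbering of the simple roots; the standard
numbering of type `A_r` plays no role in `specialCoxeter`. -/
theorem IsCoxeterElement.exists_eq_specialCoxeter {b : P.Base} {c : P.weylGroup}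
    (hc : IsCoxeterElement b c) : ∃ (r : ℕ) (e : Fin r ≃ b.support), c = specialCoxeter b e := by
  obtain ⟨l, hl, hmem, rfl⟩ := hc
  let f : Fin l.length → b.support := fun k => ⟨l.get k, (hmem _).mp (l.get_mem k)⟩
  have hf : Function.Bijective f := by
    refine ⟨fun j k h => hl.injective_get (congrArg Subtype.val h), fun x => ?_⟩
    obtain ⟨k, hk⟩ := List.get_of_mem ((hmem x).mpr x.2)
    exact ⟨k, Subtype.ext hk⟩
  refine ⟨l.length, Equiv.ofBijective f hf, ?_⟩
  simp [specialCoxeter, f]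

theorem specialCoxeter_inv {r : ℕ} (e : Fin r ≃ b.support) :
    (specialCoxeter b e)⁻¹ = specialCoxeter b (Fin.revPerm.trans e) := by
  have h : ∀ i, (refl P i)⁻¹ = refl P i := fun i => inv_eq_of_mul_eq_one_right (refl_mul_self i)
  rw [specialCoxeter, specialCoxeter, List.prod_inv_reverse, List.map_ofFn]
  congr 1
  refine List.ext_getElem (by simp) fun n h₁ h₂ => ?_
  have hn : n < r := by simpa using h₂
  have h₃ : (⟨r - 1 - n, by omega⟩ : Fin r) = Fin.rev ⟨n, hn⟩ := Fin.ext (by simp; omega)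
  simp [h, h₃]

theorem sum_eq_sum_Iio_add_add_sum_Ioi {r : ℕ} (f : Fin r → ℤ) (k : Fin r) :
    ∑ j, f j = ∑ j ∈ Finset.Iio k, f j + f k + ∑ j ∈ Finset.Ioi k, f j := by
  have h : (Finset.univ : Finset (Fin r)) = (Finset.Iio k).disjUnion {k} (by simp) ∪
      Finset.Ioi k := by
    ext j
    have := lt_trichotomy j k
    simp only [Finset.mem_univ, Finset.disjUnion_eq_union, Finset.mem_union, Finset.mem_Iio,
      Finset.mem_singleton, Finset.mem_Ioi, true_iff]
    tauto
  rw [h, Finset.sum_union, Finset.sum_disjUnion, Finset.sum_singleton]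
  rw [Finset.disjoint_left]
  intro j hj hj'
  simp only [Finset.disjUnion_eq_union, Finset.mem_union, Finset.mem_Iio,
    Finset.mem_singleton, Finset.mem_Ioi] at hj hj'
  omega

variable [CharZero K] [P.IsCrystallographic]

/-- The action of `c = s₁ ⋯ s_r` in coordinates. Split the transposed Cartan matrix as `U + L` with
`U` upper and `L` lower unitriangular: then `c = -U⁻¹ L`. This holds since the coordinate at the
`k`-th simple root is only changed by `s_k`, which acts after the later coordinates have changed
and before the earlier ones do. -/
theorem coeff_specialCoxeter_smul {r : ℕ} (e : Fin r ≃ b.support) (i : ι) (k : Fin r) :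
    coeff b (specialCoxeter b e • i) (e k) +
        ∑ j ∈ Finset.Ioi k,
          coeff b (specialCoxeter b e • i) (e j) * b.cartanMatrix (e j) (e k) =
      -(coeff b i (e k) + ∑ j ∈ Finset.Iio k, coeff b i (e j) * b.cartanMatrix (e j) (e k)) := by
  let L := List.ofFn e
  let X : P.weylGroup := ((L.take k).map fun x : b.support => refl P x).prod
  let Y : P.weylGroup := ((L.drop (k + 1)).map fun x : b.support => refl P x).prod
  have hk : (k : ℕ) < L.length := by simp [L]
  have hC : specialCoxeter b e = X * (refl P (e k) * Y) := by
    have hL : L = L.take k ++ e k :: L.drop (k + 1) := by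
      conv_lhs => rw [← List.take_append_drop k L, List.drop_eq_getElem_cons hk]
      simp [L]
    have h : specialCoxeter b e = (L.map fun x : b.support => refl P x).prod := by
      simp [specialCoxeter, L, List.map_ofFn, Function.comp_def]
    rw [h, hL]
    simp [X, Y]
  have hX : ∀ j, k ≤ j → e j ∉ L.take k := by
    intro j hj h
    obtain ⟨m, hm, h⟩ := List.mem_take_iff_getElem.mp h
    simp [L] at h hm
    have := congrArg Fin.val h
    simp at this
    omega
  have hY : ∀ j, j ≤ k → e j ∉ L.drop (k + 1) := by
    intro j hj h
    obtain ⟨m, hm, h⟩ := List.mem_drop_iff_getElem.mp h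
    simp [L] at h hm
    have := congrArg Fin.val h
    simp at this
    omega
  set y := Y • i with hy
  have hw : ∀ j, k ≤ j →
      coeff b (specialCoxeter b e • i) (e j) = coeff b (refl P (e k) • y) (e j) := by
    intro j hj
    rw [hC, mul_smul, mul_smul, coeff_prod_refl_smul_of_notMem b _ (hX j hj)]
  have hv : ∀ j, j ≤ k → coeff b y (e j) = coeff b i (e j) := fun j hj =>
    coeff_prod_refl_smul_of_notMem b _ (hY j hj) i
  have hgt : ∀ j, k < j →
      coeff b (specialCoxeter b e • i) (e j) = coeff b y (e j) := by
    intro j hj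
    rw [hw j hj.le, coeff_refl_smul_of_ne b (e.injective.ne hj.ne')]
  have h1 : ∑ j ∈ Finset.Ioi k,
      coeff b (specialCoxeter b e • i) (e j) * b.cartanMatrix (e j) (e k) =
      ∑ j ∈ Finset.Ioi k, coeff b y (e j) * b.cartanMatrix (e j) (e k) :=
    Finset.sum_congr rfl fun j hj => by rw [hgt j (Finset.mem_Ioi.mp hj)]
  have h2 : ∑ j ∈ Finset.Iio k, coeff b i (e j) * b.cartanMatrix (e j) (e k) =
      ∑ j ∈ Finset.Iio k, coeff b y (e j) * b.cartanMatrix (e j) (e k) :=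
    Finset.sum_congr rfl fun j hj => by rw [hv j (Finset.mem_Iio.mp hj).le]
  rw [h1, h2, hw k le_rfl, coeff_refl_smul_self, ← hv k le_rfl,
    ← e.sum_comp, sum_eq_sum_Iio_add_add_sum_Ioi _ k, b.cartanMatrix_apply_same]
  ring

end Coxeter

/-! ### Short cycles and dominant roots -/

section Rational

variable {ι K M N : Type*} [Field K] [CharZero K] [AddCommGroup M] [Module K M]
  [AddCommGroup N] [Module K N] {P : RootPairing ι K M N} {b : P.Base}

/-- A rational element admits no cycle of length two; a loop is the case `γ = δ`. -/
theorem IsRational.not_rootLE {u : P.weylGroup} (hu : IsRational b u) {γ δ : ι}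
    (hγ : b.IsPos γ) (hδ : b.IsPos δ) (huγ : b.IsPos (u • γ)) (huδ : b.IsPos (u • δ))
    (h : RootLE b γ (u • δ)) : ¬ RootLE b δ (u • γ) := by
  intro h'
  let x : nuZero b u := ⟨u • γ, ⟨γ, hγ, rfl⟩, huγ⟩
  let y : nuZero b u := ⟨u • δ, ⟨δ, hδ, rfl⟩, huδ⟩
  have hxy : (elementGraph b u).Adj x y := by
    change RootLE b (u⁻¹ • u • γ) (u • δ)
    rwa [inv_smul_smul]
  have hyx : (elementGraph b u).Adj y x := by
    change RootLE b (u⁻¹ • u • δ) (u • γ)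
    rwa [inv_smul_smul]
  exact hu x (.tail (.single hxy) hyx)

end Rational

section Dominant

variable {ι K M N : Type*} [Finite ι] [Field K] [CharZero K] [AddCommGroup M] [Module K M]
  [AddCommGroup N] [Module K N] {P : RootPairing ι K M N} [P.IsCrystallographic] (b : P.Base)

theorem exists_dominant_smul (i : ι) :
    ∃ u : P.weylGroup, b.IsPos (u • i) ∧ ∀ k : b.support, 0 ≤ P.pairingIn ℤ (u • i) k := by
  classical
  have : Nonempty (MulAction.orbit P.weylGroup i) := ⟨⟨i, MulAction.mem_orbit_self i⟩⟩
  obtain ⟨⟨_, u, rfl⟩, hmax⟩ :=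
    Finite.exists_max fun x : MulAction.orbit P.weylGroup i => b.height (x : ι)
  have hmax' : ∀ v : P.weylGroup, b.height (v • u • i) ≤ b.height (u • i) := fun v =>
    hmax ⟨v • u • i, v * u, mul_smul v u i⟩
  refine ⟨u, ?_, fun k => ?_⟩
  · have h : coeff b (refl P (u • i) • u • i) = -coeff b (u • i) :=
      coeff_eq_neg b (by rw [refl_smul]; simp)
    have := hmax' (refl P (u • i))
    rw [height_eq_sum_coeff, h, height_eq_sum_coeff] at this
    simp only [Pi.neg_apply, Finset.sum_neg_distrib] at this
    rw [Base.isPos_iff', height_eq_sum_coeff]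
    linarith
  · have := hmax' (refl P k)
    rw [height_eq_sum_coeff, height_eq_sum_coeff] at this
    simp only [coeff_refl_smul, Finset.sum_sub_distrib, Finset.sum_ite_eq', Finset.mem_univ,
      if_true] at this
    linarith

theorem coeff_pos_of_dominant [P.IsReduced] [P.IsIrreducible] {γ : ι} (hγ : b.IsPos γ)
    (hdom : ∀ k : b.support, 0 ≤ P.pairingIn ℤ γ k) (k : b.support) : 0 < coeff b γ k := by
  have hnn := (isPos_iff_coeff_nonneg b).mp hγ
  obtain ⟨i, hi⟩ := exists_coeff_ne_zero b γ
  refine lt_of_le_of_ne (hnn k) (Ne.symm ?_)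
  refine b.induction_on_cartanMatrix (fun k => coeff b γ k ≠ 0) hi fun i j hi hij hj => ?_
  -- A simple root outside the support pairs non-positively with `γ`, and strictly negatively
  -- if it is adjacent to the support.
  have h := hdom j
  rw [pairingIn_eq_sum_coeff] at h
  refine absurd h (not_le.mpr (Finset.sum_neg' (fun l _ => ?_) ⟨i, Finset.mem_univ _, ?_⟩))
  · rcases eq_or_ne l j with rfl | hl
    · simp [hj]
    · exact mul_nonpos_of_nonneg_of_nonpos (hnn l) (b.cartanMatrix_le_zero_of_ne l j hl)
  · have hij' : i ≠ j := fun h => hi (h ▸ hj)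
    refine mul_neg_of_pos_of_neg (lt_of_le_of_ne (hnn i) (Ne.symm hi))
      (lt_of_le_of_ne (b.cartanMatrix_le_zero_of_ne i j hij') fun h => hij ?_)
    exact b.cartanMatrix_apply_eq_zero_iff_symm.mp h

theorem rootLE_of_specialCoxeter_smul_dominant {r : ℕ} (e : Fin r ≃ b.support) {δ : ι}
    (hdom : ∀ k : b.support, 0 ≤ P.pairingIn ℤ (specialCoxeter b e • δ) k) :
    RootLE b δ (specialCoxeter b e • δ) := by
  have h : ∀ k : Fin r, coeff b δ (e k) ≤ coeff b (specialCoxeter b e • δ) (e k) := by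
    intro k
    induction k using WellFoundedLT.induction with | _ k ih
    have h1 := coeff_specialCoxeter_smul b e δ k
    have h2 := hdom (e k)
    rw [pairingIn_eq_sum_coeff, ← e.sum_comp, sum_eq_sum_Iio_add_add_sum_Ioi _ k,
      b.cartanMatrix_apply_same] at h2
    have h3 : ∑ j ∈ Finset.Iio k,
          coeff b (specialCoxeter b e • δ) (e j) * b.cartanMatrix (e j) (e k) ≤
        ∑ j ∈ Finset.Iio k, coeff b δ (e j) * b.cartanMatrix (e j) (e k) :=
      Finset.sum_le_sum fun j hj => mul_le_mul_of_nonpos_right (ih j (Finset.mem_Iio.mp hj))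
        (b.cartanMatrix_le_zero_of_ne _ _ (e.injective.ne (Finset.mem_Iio.mp hj).ne))
    linarith
  rw [rootLE_iff_coeff_le]
  intro k
  simpa using h (e.symm k)

/-- If `c = s₁ ⋯ s_r` is rational then `c⁻¹` sends every dominant root `γ` to `-α_r`. Indeed
`c⁻¹ γ ≤ γ`, so that `c⁻¹ γ` is negative, for otherwise `γ` would carry a loop; but
`s_{r-1} ⋯ s₁ γ` is still positive, having the same coordinate at `α_r` as `γ`. -/
theorem IsRational.inv_smul_dominant [P.IsReduced] [P.IsIrreducible] {n : ℕ}
    (e : Fin (n + 1) ≃ b.support) (hc : IsRational b (specialCoxeter b e)) {γ : ι}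
    (hγ : b.IsPos γ) (hdom : ∀ k : b.support, 0 ≤ P.pairingIn ℤ γ k) :
    (specialCoxeter b e)⁻¹ • γ = refl P (e (Fin.last n)) • (e (Fin.last n) : ι) := by
  set l : b.support := e (Fin.last n) with hl
  let X : P.weylGroup :=
    ((List.ofFn fun k : Fin n => e k.castSucc).map fun x : b.support => refl P x).prod
  have hX : specialCoxeter b e = X * refl P l := by
    rw [specialCoxeter, List.ofFn_succ', List.concat_eq_append, List.prod_append]
    simp [X, List.map_ofFn, Function.comp_def, hl]
  have hc' : (specialCoxeter b e)⁻¹ • γ = refl P l • X⁻¹ • γ := by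
    rw [hX, mul_inv_rev, mul_smul, inv_eq_of_mul_eq_one_right (refl_mul_self _)]
  have hneg : ¬ b.IsPos ((specialCoxeter b e)⁻¹ • γ) := by
    intro hpos
    have h : specialCoxeter b e • (specialCoxeter b e)⁻¹ • γ = γ := smul_inv_smul _ _
    have hle := rootLE_of_specialCoxeter_smul_dominant b e
      (δ := (specialCoxeter b e)⁻¹ • γ) (by rwa [h])
    exact hc.not_rootLE hpos hpos (by rwa [h]) (by rwa [h]) hle hle
  have hXpos : b.IsPos (X⁻¹ • γ) := by
    have hmem : l ∉ List.ofFn fun k : Fin n => e k.castSucc := by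
      simp [hl, List.mem_ofFn, Fin.castSucc_ne_last]
    have h := coeff_prod_refl_smul_of_notMem b _ hmem (X⁻¹ • γ)
    change coeff b (X • X⁻¹ • γ) l = _ at h
    rw [smul_inv_smul] at h
    exact isPos_of_coeff_pos b (h ▸ coeff_pos_of_dominant b hγ hdom l)
  rw [hc'] at hneg ⊢
  by_contra hne
  exact hneg (hXpos.reflectionPerm l.2 fun h => hne (by rw [h]))

/-- If a Coxeter element is rational, then the root system is simply laced: each orbit of the Weyl
group on the roots contains a dominant root, and there is only one of those. -/
theorem IsRational.cartanMatrix_symm [P.IsReduced] [P.IsIrreducible] {n : ℕ}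
    (e : Fin (n + 1) ≃ b.support) (hc : IsRational b (specialCoxeter b e)) (i j : b.support) :
    b.cartanMatrix i j = b.cartanMatrix j i := by
  have : Fintype ι := Fintype.ofFinite ι
  let B := P.toInvariantForm
  have hlen : ∀ i : ι, B.form (P.root i) (P.root i) =
      B.form (P.root (e (Fin.last n))) (P.root (e (Fin.last n))) := by
    intro i
    obtain ⟨u, hu, hdom⟩ := exists_dominant_smul b i
    have h := hc.inv_smul_dominant b e hu hdom
    rw [← InvariantForm.apply_weylGroup_smul P (B := B) u,
      ← InvariantForm.apply_weylGroup_smul P (B := B) (specialCoxeter b e)⁻¹,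
      ← root_smul, ← root_smul, h, root_smul, InvariantForm.apply_weylGroup_smul P]
  have h := B.pairing_mul_eq_pairing_mul_swap i j
  rw [hlen i, hlen j] at h
  have h' := mul_right_cancel₀ (B.ne_zero _) h
  apply FaithfulSMul.algebraMap_injective ℤ K
  rw [Base.algebraMap_cartanMatrixIn_apply, Base.algebraMap_cartanMatrixIn_apply, h']

theorem cartanMatrix_eq_zero_or_neg_one
    (hsymm : ∀ i j, b.cartanMatrix i j = b.cartanMatrix j i) {i j : b.support} (hij : i ≠ j) :
    b.cartanMatrix i j = 0 ∨ b.cartanMatrix i j = -1 := by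
  have h1 := P.pairingIn_pairingIn_mem_set_of_isCrystallographic i j
  have h2 : P.pairingIn ℤ i j = P.pairingIn ℤ j i := hsymm i j
  have h3 := b.cartanMatrix_mem_of_ne hij
  simp only [Base.cartanMatrix, Base.cartanMatrixIn_def] at h3 ⊢
  rw [← h2] at h1
  simp only [Set.mem_insert_iff, Set.mem_singleton_iff, Prod.mk.injEq] at h1 h3
  have h4 : P.pairingIn ℤ i j ≠ -2 := fun h =>
    b.root_ne_neg_of_ne i.2 j.2 (Subtype.coe_injective.ne hij)
      ((P.pairingIn_neg_two_neg_two_iff ℤ i j).mp ⟨h, h2 ▸ h⟩)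
  generalize P.pairingIn ℤ i j = x at h1 h3 h4 ⊢
  omega

end Dominant

/-! ### The shape of the Dynkin diagram -/

section Combinatorics

variable {n : ℕ} {A : Matrix (Fin (n + 1)) (Fin (n + 1)) ℤ} {m : Fin (n + 1) → ℤ}

theorem sum_mul_le_neg {r : ℕ} {A : Matrix (Fin r) (Fin r) ℤ} {m : Fin r → ℤ}
    (hA : ∀ i j, i ≠ j → A i j = 0 ∨ A i j = -1) (hm : ∀ i, 0 < m i) {s t : Finset (Fin r)}
    {k : Fin r} (hk : k ∉ s) (hts : t ⊆ s) (ht : ∀ i ∈ t, A i k ≠ 0) :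
    ∑ i ∈ s, m i * A i k ≤ -∑ i ∈ t, m i := by
  have hne : ∀ i ∈ s, i ≠ k := fun i hi h => hk (h ▸ hi)
  have h1 : ∑ i ∈ t, m i = ∑ i ∈ t, -(m i * A i k) :=
    Finset.sum_congr rfl fun i hi => by
      rw [(hA i k (hne i (hts hi))).resolve_left (ht i hi)]
      ring
  have h2 : ∑ i ∈ t, -(m i * A i k) ≤ ∑ i ∈ s, -(m i * A i k) :=
    Finset.sum_le_sum_of_subset_of_nonneg hts fun i hi _ => by
      rcases hA i k (hne i hi) with h | h <;> rw [h]
      · simp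
      · simpa using (hm i).le
  rw [Finset.sum_neg_distrib (s := s)] at h2
  linarith

/-- In the oriented diagram with an edge `i → j` for `i < j` adjacent, let `m` be a positive
weight which at each vertex but the last equals the sum over its out-neighbours, and is at least
the sum over its in-neighbours. Then out-neighbours are unique. -/
theorem out_neighbor_unique (hA : ∀ i j, i ≠ j → A i j = 0 ∨ A i j = -1)
    (hsymm : ∀ i j, A i j = A j i) (hm : ∀ i, 0 < m i)
    (hout : ∀ k ≠ Fin.last n, m k + ∑ i ∈ Finset.Ioi k, m i * A i k = 0)
    (hin : ∀ k ≠ Fin.last n, 0 ≤ m k + ∑ i ∈ Finset.Iio k, m i * A i k)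
    {i j k : Fin (n + 1)} (hkj : k < j) (hki : k < i) (hi : A i k ≠ 0) (hj : A j k ≠ 0) :
    i = j := by
  wlog hlast : i ≠ Fin.last n generalizing i j
  · by_contra hij
    have hj' : j ≠ Fin.last n := fun h => hij ((not_not.mp hlast).trans h.symm)
    exact hij (this hki hkj hj hi hj').symm
  by_contra hij
  have h1 := sum_mul_le_neg hA hm (s := Finset.Ioi k) (t := {i, j}) (k := k) (by simp)
    (by simp [Finset.insert_subset_iff, hki, hkj]) (by simp [hi, hj])
  rw [Finset.sum_pair hij] at h1
  have h2 := sum_mul_le_neg hA hm (s := Finset.Iio i) (t := {k}) (k := i) (by simp)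
    (by simp [hki]) (by simpa [hsymm k i] using hi)
  rw [Finset.sum_singleton] at h2
  have h3 := hout k (ne_of_lt (lt_of_lt_of_le hki (Fin.le_last i)))
  have h4 := hin i hlast
  have h5 := hm j
  linarith

/-- Under the same hypotheses, in-neighbours of a vertex other than the last one are unique. -/
theorem in_neighbor_unique (hA : ∀ i j, i ≠ j → A i j = 0 ∨ A i j = -1)
    (hsymm : ∀ i j, A i j = A j i) (hm : ∀ i, 0 < m i)
    (hout : ∀ k ≠ Fin.last n, m k + ∑ i ∈ Finset.Ioi k, m i * A i k = 0)
    (hin : ∀ k ≠ Fin.last n, 0 ≤ m k + ∑ i ∈ Finset.Iio k, m i * A i k)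
    {i j k : Fin (n + 1)} (hk : k ≠ Fin.last n) (hik : i < k) (hjk : j < k)
    (hi : A i k ≠ 0) (hj : A j k ≠ 0) : i = j := by
  by_contra hij
  have h1 := sum_mul_le_neg hA hm (s := Finset.Iio k) (t := {i, j}) (k := k) (by simp)
    (by simp [Finset.insert_subset_iff, hik, hjk]) (by simp [hi, hj])
  rw [Finset.sum_pair hij] at h1
  have h2 := sum_mul_le_neg hA hm (s := Finset.Ioi i) (t := {k}) (k := i) (by simp)
    (by simp [hik]) (by simpa [hsymm k i] using hi)
  rw [Finset.sum_singleton] at h2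
  have h3 := hout i (ne_of_lt (lt_of_lt_of_le hik (Fin.le_last k)))
  have h4 := hin k hk
  have h5 := hm j
  linarith

/-- An ordered diagram in which every vertex but the last has an out-neighbour, and no vertex has
two in-neighbours, is a path numbered consecutively. -/
theorem eq_cartanMatrix_A_of_neighbors (hdiag : ∀ i, A i i = 2)
    (hA : ∀ i j, i ≠ j → A i j = 0 ∨ A i j = -1) (hsymm : ∀ i j, A i j = A j i)
    (hout : ∀ k ≠ Fin.last n, ∃ i, k < i ∧ A i k ≠ 0)
    (hin : ∀ i j k, i < k → j < k → A i k ≠ 0 → A j k ≠ 0 → i = j) :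
    A = CartanMatrix.A (n + 1) := by
  have hsucc : ∀ k l : Fin (n + 1), (k : ℕ) + 1 = l → A k l ≠ 0 := by
    intro k
    induction k using WellFoundedGT.induction with | _ k ih
    intro l hkl
    obtain ⟨i, hki, hi⟩ := hout k (by rintro rfl; have := l.2; simp at hkl; omega)
    rw [hsymm] at hi
    -- If the out-neighbour `i` of `k` were not `k + 1`, then `i - 1` would be a second
    -- in-neighbour of `i`, by downward induction.
    have hil : i = l := by
      by_contra hil
      have hki' : (k : ℕ) < i := hki
      have hil' : (i : ℕ) ≠ l := fun h => hil (Fin.ext h)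
      let p : Fin (n + 1) := ⟨i - 1, by omega⟩
      have hp := ih p (Fin.mk_lt_mk.mpr (by omega : (k : ℕ) < i - 1)) i
        (by simp only [p]; omega)
      have := hin k p i hki (Fin.mk_lt_mk.mpr (by omega : (i : ℕ) - 1 < i)) hi hp
      have := congrArg Fin.val this
      simp only [p] at this
      omega
    exact hil ▸ hi
  have hlt : ∀ i j : Fin (n + 1), i < j → A i j = CartanMatrix.A (n + 1) i j := by
    intro i j hij
    have hij' : (i : ℕ) < j := hij
    by_cases h : (i : ℕ) + 1 = j
    · rw [(hA i j hij.ne).resolve_left (hsucc i j h)]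
      simp [CartanMatrix.A, hij.ne, h]
    · have h0 : A i j = 0 := by
        by_contra h0
        let p : Fin (n + 1) := ⟨j - 1, by omega⟩
        have hp := hsucc p j (by simp only [p]; omega)
        have := hin i p j hij (Fin.mk_lt_mk.mpr (by omega : (j : ℕ) - 1 < j)) h0 hp
        have := congrArg Fin.val this
        simp only [p] at this
        omega
      rw [h0]
      have h' : ¬ ((j : ℕ) + 1 = i) := by omega
      simp [CartanMatrix.A, hij.ne, h, h']
  ext i j
  rcases lt_trichotomy i j with h | rfl | h
  · exact hlt i j h
  · simp [CartanMatrix.A, hdiag]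
  · rw [hsymm, hlt j i h]
    simp [CartanMatrix.A, h.ne, h.ne', or_comm]

end Combinatorics

section Rational

variable {ι K M N : Type*} [Field K] [CharZero K] [AddCommGroup M] [Module K M]
  [AddCommGroup N] [Module K N] {P : RootPairing ι K M N} [P.IsCrystallographic] (b : P.Base)

/-- If the last simple root has two in-neighbours `p` and `q`, which have no other out-neighbours,
then `c α_p` and `c α_q` form a cycle of length two. -/
theorem IsRational.in_neighbor_last_unique {n : ℕ} (e : Fin (n + 1) ≃ b.support)
    (hc : IsRational b (specialCoxeter b e))
    (hA : ∀ i j, i ≠ j → b.cartanMatrix (e i) (e j) = 0 ∨ b.cartanMatrix (e i) (e j) = -1)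
    (hsymm : ∀ i j, b.cartanMatrix (e i) (e j) = b.cartanMatrix (e j) (e i))
    (huniq : ∀ i j k, k < j → k < i → b.cartanMatrix (e i) (e k) ≠ 0 →
      b.cartanMatrix (e j) (e k) ≠ 0 → i = j)
    {p q : Fin (n + 1)} (hp : p < Fin.last n) (hq : q < Fin.last n)
    (hpl : b.cartanMatrix (e p) (e (Fin.last n)) ≠ 0)
    (hql : b.cartanMatrix (e q) (e (Fin.last n)) ≠ 0) : p = q := by
  classical
  by_contra hpq
  have hsimple : ∀ i j : Fin (n + 1), coeff b (e i) (e j) = if j = i then 1 else 0 := by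
    intro i j
    rw [coeff_simple, Pi.single_apply]
    simp
  -- The coordinate of `c α_q` at `α_p` equals the one at the last simple root, which is `1`.
  have key : ∀ p q : Fin (n + 1), p < Fin.last n → q < Fin.last n → p ≠ q →
      b.cartanMatrix (e p) (e (Fin.last n)) ≠ 0 → b.cartanMatrix (e q) (e (Fin.last n)) ≠ 0 →
      coeff b (specialCoxeter b e • (e q : ι)) (e p) = 1 := by
    intro p q hp hq hpq hpl hql
    have hsum : ∀ k, ∑ j ∈ Finset.Iio k, coeff b (e q) (e j) * b.cartanMatrix (e j) (e k) =
        if q < k then b.cartanMatrix (e q) (e k) else 0 := by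
      intro k
      simp [hsimple]
    have hlast := coeff_specialCoxeter_smul b e (e q) (Fin.last n)
    rw [hsum, hsimple, if_neg hq.ne', if_pos hq, (hA q _ hq.ne).resolve_left hql] at hlast
    have hI : Finset.Ioi (Fin.last n) = ∅ := by
      ext j
      simp [Fin.le_last]
    simp only [hI, Finset.sum_empty] at hlast
    have h := coeff_specialCoxeter_smul b e (e q) p
    have hpl' : b.cartanMatrix (e (Fin.last n)) (e p) ≠ 0 := by rwa [hsymm]
    have hql' : b.cartanMatrix (e (Fin.last n)) (e q) ≠ 0 := by rwa [hsymm]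
    have hqp : (if q < p then b.cartanMatrix (e q) (e p) else 0) = 0 := by
      split_ifs with hlt
      · by_contra h0
        exact hp.ne (huniq p (Fin.last n) q hq hlt (by rwa [hsymm]) hql')
      · rfl
    rw [hsum, hsimple, if_neg hpq, hqp, Finset.sum_eq_single (Fin.last n),
      (hA _ p hp.ne').resolve_left hpl'] at h
    · linarith
    · intro j hj hjl
      rw [Finset.mem_Ioi] at hj
      by_contra h0
      exact hjl (huniq j (Fin.last n) p hp hj (right_ne_zero_of_mul h0) hpl')
    · intro hn
      exact absurd (Finset.mem_Ioi.mpr hp) hn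
  have hle : ∀ p q : Fin (n + 1), coeff b (specialCoxeter b e • (e q : ι)) (e p) = 1 →
      RootLE b (e p) (specialCoxeter b e • (e q : ι)) := by
    intro p q h
    have hpos := isPos_of_coeff_pos b (h ▸ one_pos)
    rw [rootLE_iff_coeff_le]
    intro k
    rw [coeff_simple, Pi.single_apply]
    split_ifs with hk
    · rw [hk, h]
    · exact (isPos_iff_coeff_nonneg b).mp hpos k
  have h1 := key p q hp hq hpq hpl hql
  have h2 := key q p hq hp (Ne.symm hpq) hql hpl
  exact hc.not_rootLE (Base.isPos_of_mem_support (e p).2) (Base.isPos_of_mem_support (e q).2)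
    (isPos_of_coeff_pos b (h2 ▸ one_pos)) (isPos_of_coeff_pos b (h1 ▸ one_pos))
    (hle p q h1) (hle q p h2)

/-- If `s₁ ⋯ s_r` is rational, then the numbering used is a standard one of type `A_r`. -/
theorem IsRational.isTypeANumbering [Finite ι] [P.IsReduced] [P.IsIrreducible] {n : ℕ}
    (e : Fin (n + 1) ≃ b.support) (hc : IsRational b (specialCoxeter b e)) :
    IsTypeANumbering b e := by
  classical
  have hsymm := hc.cartanMatrix_symm b e
  let A : Matrix (Fin (n + 1)) (Fin (n + 1)) ℤ := fun i j => b.cartanMatrix (e i) (e j)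
  have hA : ∀ i j, i ≠ j → A i j = 0 ∨ A i j = -1 := fun i j hij =>
    cartanMatrix_eq_zero_or_neg_one b hsymm (e.injective.ne hij)
  have hAsymm : ∀ i j, A i j = A j i := fun i j => hsymm (e i) (e j)
  obtain ⟨u, hγ, hdom⟩ := exists_dominant_smul b (e 0 : ι)
  set γ := u • (e 0 : ι)
  let m : Fin (n + 1) → ℤ := fun k => coeff b γ (e k)
  have hm : ∀ k, 0 < m k := fun k => coeff_pos_of_dominant b hγ hdom (e k)
  -- The dominant root is `-c α_r`, and its coordinates satisfy the Coxeter equation.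
  have hinv := hc.inv_smul_dominant b e hγ hdom
  have hneg : ∀ k, coeff b (refl P (e (Fin.last n)) • (e (Fin.last n) : ι)) (e k) =
      if k = Fin.last n then -1 else 0 := by
    intro k
    rw [coeff_eq_neg b (j := e (Fin.last n)) (by rw [refl_smul]; simp), coeff_simple]
    simp only [Pi.neg_apply, Pi.single_apply, e.injective.eq_iff]
    split_ifs <;> simp
  have hcγ : specialCoxeter b e • refl P (e (Fin.last n)) • (e (Fin.last n) : ι) = γ := by
    rw [← hinv, smul_inv_smul]
  have hout : ∀ k ≠ Fin.last n, m k + ∑ i ∈ Finset.Ioi k, m i * A i k = 0 := by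
    intro k hk
    have h := coeff_specialCoxeter_smul b e
      (refl P (e (Fin.last n)) • (e (Fin.last n) : ι)) k
    rw [hcγ, hneg, if_neg hk, Finset.sum_eq_zero (s := Finset.Iio k)] at h
    · simpa using h
    · intro j hj
      rw [hneg, if_neg, zero_mul]
      exact ne_of_lt (lt_of_lt_of_le (Finset.mem_Iio.mp hj) (Fin.le_last k))
  have hin : ∀ k ≠ Fin.last n, 0 ≤ m k + ∑ i ∈ Finset.Iio k, m i * A i k := by
    intro k hk
    have h := hdom (e k)
    rw [pairingIn_eq_sum_coeff, ← e.sum_comp, sum_eq_sum_Iio_add_add_sum_Ioi _ k,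
      b.cartanMatrix_apply_same] at h
    have := hout k hk
    simp only [A, m] at this ⊢
    linarith
  have hfinal : A = CartanMatrix.A (n + 1) := by
    refine eq_cartanMatrix_A_of_neighbors (fun i => b.cartanMatrix_apply_same (e i)) hA hAsymm
      (fun k hk => ?_) fun i j k hik hjk hi hj => ?_
    · by_contra! h
      have h' := hout k hk
      rw [Finset.sum_eq_zero fun i hi => by rw [h i (Finset.mem_Ioi.mp hi), mul_zero]] at h'
      have := hm k
      linarith
    · rcases eq_or_ne k (Fin.last n) with rfl | hk
      · exact hc.in_neighbor_last_unique b e hA hAsymm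
          (fun i j k hkj hki hi hj => out_neighbor_unique hA hAsymm hm hout hin hkj hki hi hj)
          hik hjk hi hj
      · exact in_neighbor_unique hA hAsymm hm hout hin hk hik hjk hi hj
  exact fun i j => congrFun (congrFun hfinal i) j

end Rational

/-! ### Type `A` -/

section Reversal

variable {ι K M N : Type*} [Field K] [AddCommGroup M] [Module K M]
  [AddCommGroup N] [Module K N] {P : RootPairing ι K M N} [P.IsCrystallographic] {b : P.Base}

theorem IsTypeANumbering.rev {r : ℕ} {e : Fin r ≃ b.support}
    (he : IsTypeANumbering b e) :
    IsTypeANumbering b (Fin.revPerm.trans e) := by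
  intro i j
  simp only [Equiv.trans_apply, Fin.revPerm_apply]
  rw [he]
  simp only [CartanMatrix.A, Matrix.of_apply, Fin.ext_iff, Fin.val_rev]
  split_ifs <;> omega

end Reversal

section TypeA

variable {ι K M N : Type*} [Field K] [CharZero K] [AddCommGroup M] [Module K M]
  [AddCommGroup N] [Module K N] {P : RootPairing ι K M N} (b : P.Base)

/-- The coordinates of the root with index `i` along a numbering of the simple roots, extended
by zero to all natural numbers; the numbering starts at `0`. -/
noncomputable def natCoeff {r : ℕ} (e : Fin r ≃ b.support) (i : ι) (k : ℕ) : ℤ :=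
  if h : k < r then coeff b i (e ⟨k, h⟩) else 0

variable {r : ℕ} (e : Fin r ≃ b.support)

theorem natCoeff_fin (i : ι) (k : Fin r) : natCoeff b e i k = coeff b i (e k) := by
  simp [natCoeff]

theorem natCoeff_of_le (i : ι) {k : ℕ} (h : r ≤ k) : natCoeff b e i k = 0 := by
  simp [natCoeff, not_lt.mpr h]

theorem natCoeff_nonneg {i : ι} (hi : b.IsPos i) (k : ℕ) : 0 ≤ natCoeff b e i k := by
  unfold natCoeff
  split_ifs
  exacts [(isPos_iff_coeff_nonneg b).mp hi _, le_rfl]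

theorem isPos_of_natCoeff_pos {i : ι} {k : ℕ} (h : 0 < natCoeff b e i k) : b.IsPos i := by
  unfold natCoeff at h
  split_ifs at h
  exacts [isPos_of_coeff_pos b h, absurd h (lt_irrefl 0)]

theorem rootLE_iff_natCoeff_le {i j : ι} :
    RootLE b i j ↔ ∀ k, natCoeff b e i k ≤ natCoeff b e j k := by
  rw [rootLE_iff_coeff_le]
  refine ⟨fun h k => ?_, fun h k => ?_⟩
  · unfold natCoeff
    split_ifs
    exacts [h _, le_rfl]
  · simpa [natCoeff_fin] using h (e.symm k)

theorem exists_natCoeff_ne_zero (i : ι) : ∃ k, natCoeff b e i k ≠ 0 := by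
  obtain ⟨k, hk⟩ := exists_coeff_ne_zero b i
  exact ⟨e.symm k, by simpa [natCoeff_fin] using hk⟩

/-- A criterion for rationality: it suffices that `u`, as long as it keeps a positive root
positive, moves the smallest index in its support to the right. That index then strictly decreases
along the edges of the graph of `u`. -/
theorem isRational_of_min_support_lt {u : P.weylGroup}
    (h : ∀ γ, b.IsPos γ → b.IsPos (u • γ) → ∀ m, natCoeff b e γ m ≠ 0 →
      (∀ k < m, natCoeff b e γ k = 0) → ∀ k ≤ m, natCoeff b e (u • γ) k = 0) :
    IsRational b u := by
  classical
  let d : nuZero b u → ℕ := fun α => Nat.find (exists_natCoeff_ne_zero b e (α : ι))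
  have hd : ∀ α β, (elementGraph b u).Adj α β → d β < d α := by
    rintro ⟨_, ⟨γ, hγ, rfl⟩, huγ⟩ β hle
    change RootLE b (u⁻¹ • u • γ) β at hle
    rw [inv_smul_smul, rootLE_iff_natCoeff_le b e] at hle
    have hex := exists_natCoeff_ne_zero b e γ
    have hm := Nat.find_spec hex
    have hmin : ∀ k < Nat.find hex, natCoeff b e γ k = 0 := fun k hk =>
      not_not.mp (Nat.find_min hex hk)
    have h1 : d β ≤ Nat.find hex := by
      refine Nat.find_min' _ (ne_of_gt (lt_of_lt_of_le ?_ (hle _)))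
      exact lt_of_le_of_ne (natCoeff_nonneg b e hγ _) (Ne.symm hm)
    refine lt_of_le_of_lt h1 ?_
    by_contra! hlt
    exact Nat.find_spec (exists_natCoeff_ne_zero b e (u • γ)) (h γ hγ huγ _ hm hmin _ hlt)
  have hd' : ∀ α β, Relation.TransGen (elementGraph b u).Adj α β → d β < d α := by
    intro α β hαβ
    induction hαβ with
    | single h => exact hd _ _ h
    | tail _ h ih => exact (hd _ _ h).trans ih
  exact fun α hα => lt_irrefl _ (hd' α α hα)

variable [P.IsCrystallographic] {b e}

theorem IsTypeANumbering.sum_Ioi (he : IsTypeANumbering b e) (i : ι) (k : Fin r) :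
    ∑ j ∈ Finset.Ioi k, coeff b i (e j) * b.cartanMatrix (e j) (e k) =
      -natCoeff b e i (k + 1) := by
  by_cases hk : (k : ℕ) + 1 < r
  · rw [Finset.sum_eq_single ⟨k + 1, hk⟩, he, natCoeff, dif_pos hk]
    · simp [CartanMatrix.A, Fin.ext_iff]
    · intro j hj hne
      have hj' : (k : ℕ) < j := Fin.lt_def.mp (Finset.mem_Ioi.mp hj)
      have hne' : (j : ℕ) ≠ k + 1 := fun h => hne (Fin.ext h)
      rw [he]
      simp only [CartanMatrix.A, Matrix.of_apply, Fin.ext_iff]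
      rw [if_neg (by omega), if_neg (by omega), mul_zero]
    · intro h
      exact absurd (Finset.mem_Ioi.mpr (Fin.mk_lt_mk.mpr (Nat.lt_succ_self k))) h
  · rw [natCoeff_of_le b e i (not_lt.mp hk), neg_zero]
    refine Finset.sum_eq_zero fun j hj => ?_
    have hj' : (k : ℕ) < j := Fin.lt_def.mp (Finset.mem_Ioi.mp hj)
    omega

theorem IsTypeANumbering.sum_Iio (he : IsTypeANumbering b e) (i : ι) (k : Fin r) :
    ∑ j ∈ Finset.Iio k, coeff b i (e j) * b.cartanMatrix (e j) (e k) =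
      -if (k : ℕ) = 0 then 0 else natCoeff b e i (k - 1) := by
  split_ifs with hk
  · rw [neg_zero]
    refine Finset.sum_eq_zero fun j hj => ?_
    have hj' : (j : ℕ) < k := Fin.lt_def.mp (Finset.mem_Iio.mp hj)
    omega
  · have hk' : (k : ℕ) - 1 < r := by omega
    rw [Finset.sum_eq_single ⟨k - 1, hk'⟩, he, natCoeff, dif_pos hk']
    · simp only [CartanMatrix.A, Matrix.of_apply, Fin.ext_iff]
      rw [if_neg (by omega), if_pos (by omega)]
      ring
    · intro j hj hne
      have hj' : (j : ℕ) < k := Fin.lt_def.mp (Finset.mem_Iio.mp hj)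
      have hne' : (j : ℕ) ≠ k - 1 := fun h => hne (Fin.ext h)
      rw [he]
      simp only [CartanMatrix.A, Matrix.of_apply, Fin.ext_iff]
      rw [if_neg (by omega), if_neg (by omega), mul_zero]
    · intro h
      exact absurd (Finset.mem_Iio.mpr (Fin.mk_lt_mk.mpr (by omega : (k : ℕ) - 1 < k))) h

/-- In type `A`, the element `s₁ ⋯ s_r` shifts the coordinates up by one, and then adds a multiple
of the all-one vector. -/
theorem IsTypeANumbering.natCoeff_specialCoxeter_smul (he : IsTypeANumbering b e) (i : ι) {k : ℕ}
    (hk : k < r) :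
    natCoeff b e (specialCoxeter b e • i) (k + 1) =
      natCoeff b e i k + natCoeff b e (specialCoxeter b e • i) 0 := by
  induction k with
  | zero =>
    have h := coeff_specialCoxeter_smul b e i ⟨0, hk⟩
    rw [he.sum_Ioi, he.sum_Iio, ← natCoeff_fin, ← natCoeff_fin] at h
    simp only [if_true] at h
    linarith
  | succ k ih =>
    have h := coeff_specialCoxeter_smul b e i ⟨k + 1, hk⟩
    rw [he.sum_Ioi, he.sum_Iio, ← natCoeff_fin, ← natCoeff_fin] at h
    simp only [Nat.add_eq_zero_iff, one_ne_zero, and_false, if_false, Nat.add_sub_cancel] at h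
    have := ih (by omega)
    linarith

theorem IsTypeANumbering.natCoeff_last_add (he : IsTypeANumbering b e) (i : ι) :
    natCoeff b e i (r - 1) + natCoeff b e (specialCoxeter b e • i) 0 = 0 := by
  rcases r with _ | n
  · simp [natCoeff]
  · rw [Nat.add_sub_cancel, ← he.natCoeff_specialCoxeter_smul i (Nat.lt_succ_self n)]
    exact natCoeff_of_le b e _ le_rfl

theorem IsTypeANumbering.natCoeff_refl_smul_self (he : IsTypeANumbering b e) (i : ι)
    (k : Fin r) :
    natCoeff b e (refl P (e k) • i) k =
      -natCoeff b e i k + natCoeff b e i (k + 1) +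
        if (k : ℕ) = 0 then 0 else natCoeff b e i (k - 1) := by
  rw [natCoeff_fin, coeff_refl_smul_self, ← e.sum_comp, sum_eq_sum_Iio_add_add_sum_Ioi _ k,
    he.sum_Ioi, he.sum_Iio, b.cartanMatrix_apply_same, natCoeff_fin]
  ring

theorem natCoeff_refl_smul_of_ne (i : ι) (k : Fin r) {j : ℕ} (hj : j ≠ k) :
    natCoeff b e (refl P (e k) • i) j = natCoeff b e i j := by
  unfold natCoeff
  split_ifs with h
  · exact coeff_refl_smul_of_ne b (e.injective.ne fun h => hj (congrArg Fin.val h)) i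
  · rfl

/-- In type `A`, every interval of simple roots sums to a root. -/
theorem IsTypeANumbering.exists_natCoeff_eq_indicator (he : IsTypeANumbering b e) {a d : ℕ}
    (had : a ≤ d) (hd : d < r) :
    ∃ γ : ι, ∀ k, natCoeff b e γ k = if a ≤ k ∧ k ≤ d then 1 else 0 := by
  classical
  obtain ⟨t, rfl⟩ := Nat.exists_eq_add_of_le had
  clear had
  induction t generalizing a with
  | zero =>
    rw [add_zero] at hd ⊢
    refine ⟨e ⟨a, hd⟩, fun k => ?_⟩
    unfold natCoeff
    split_ifs with h h' h'
    · obtain rfl : k = a := by omega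
      simp [coeff_simple]
    · have hne : (⟨k, h⟩ : Fin r) ≠ ⟨a, hd⟩ := fun h => h' (by
        rw [Fin.mk.injEq] at h
        omega)
      rw [coeff_simple, Pi.single_apply, if_neg (e.injective.ne hne)]
    · omega
    · rfl
  | succ t ih =>
    obtain ⟨γ, hγ⟩ := ih (a := a + 1) (by omega)
    refine ⟨refl P (e ⟨a, by omega⟩) • γ, fun k => ?_⟩
    by_cases hk : k = a
    · subst hk
      rw [he.natCoeff_refl_smul_self γ ⟨k, _⟩]
      simp only [hγ]
      split_ifs <;> omega
    · rw [natCoeff_refl_smul_of_ne γ ⟨a, _⟩ hk, hγ]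
      split_ifs <;> omega

theorem IsTypeANumbering.isRational_specialCoxeter (he : IsTypeANumbering b e) :
    IsRational b (specialCoxeter b e) := by
  refine isRational_of_min_support_lt b e fun γ hγ hcγ m _ hmin k hk => ?_
  have h1 := he.natCoeff_last_add γ
  have h2 := natCoeff_nonneg b e hγ (r - 1)
  have h3 := natCoeff_nonneg b e hcγ 0
  rcases k with _ | k
  · linarith
  · by_cases hkr : k < r
    · rw [he.natCoeff_specialCoxeter_smul γ hkr, hmin k hk]
      linarith
    · exact natCoeff_of_le b e _ (by omega)

/-- Left multiplication by the last simple reflection keeps `s₁ ⋯ s_r` rational. -/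
theorem IsTypeANumbering.isRational_refl_last_mul (he : IsTypeANumbering b e) (hr : 2 ≤ r) :
    IsRational b (refl P (e ⟨r - 1, by omega⟩) * specialCoxeter b e) := by
  refine isRational_of_min_support_lt b e fun γ hγ hcγ m hm hmin k hk => ?_
  rw [mul_smul] at hcγ ⊢
  have h1 := he.natCoeff_last_add γ
  have h2 := natCoeff_nonneg b e hγ (r - 1)
  have h3 := natCoeff_nonneg b e hcγ 0
  rw [natCoeff_refl_smul_of_ne _ ⟨r - 1, _⟩ (by simp only; omega)] at h3
  have hmr : m < r - 1 := by
    by_contra! h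
    rcases h.eq_or_lt with rfl | h
    · exact hm (by linarith)
    · exact hm (natCoeff_of_le b e _ (by omega))
  rw [natCoeff_refl_smul_of_ne _ ⟨r - 1, _⟩ (by simp only; omega)]
  rcases k with _ | k
  · linarith
  · rw [he.natCoeff_specialCoxeter_smul γ (by omega), hmin k hk]
    linarith

/-- Left multiplication by another simple reflection `s_i` destroys rationality: with
`γ = α_i + ⋯ + α_{r-1}`, the root `s_i c γ = γ + α_r` carries a loop. -/
theorem IsTypeANumbering.not_isRational_refl_mul (he : IsTypeANumbering b e) (i : Fin r)
    (hi : (i : ℕ) ≠ r - 1) : ¬ IsRational b (refl P (e i) * specialCoxeter b e) := by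
  intro hrat
  obtain ⟨γ, hγ⟩ := he.exists_natCoeff_eq_indicator (a := i) (d := r - 2) (by omega) (by omega)
  have h0 : natCoeff b e (specialCoxeter b e • γ) 0 = 0 := by
    have := he.natCoeff_last_add γ
    rw [hγ, if_neg (by omega)] at this
    linarith
  have hc : ∀ k, natCoeff b e (specialCoxeter b e • γ) k =
      if (i : ℕ) + 1 ≤ k ∧ k ≤ r - 1 then 1 else 0 := by
    intro k
    rcases k with _ | k
    · rw [h0, if_neg (by omega)]
    · by_cases hkr : k < r
      · rw [he.natCoeff_specialCoxeter_smul γ hkr, h0, hγ]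
        split_ifs <;> omega
      · rw [natCoeff_of_le b e _ (by omega), if_neg (by omega)]
  have hs : ∀ k, natCoeff b e ((refl P (e i) * specialCoxeter b e) • γ) k =
      if (i : ℕ) ≤ k ∧ k ≤ r - 1 then 1 else 0 := by
    intro k
    rw [mul_smul]
    by_cases hk : k = i
    · rw [hk, he.natCoeff_refl_smul_self]
      simp only [hc]
      split_ifs <;> omega
    · rw [natCoeff_refl_smul_of_ne _ i hk, hc]
      split_ifs <;> omega
  have hγpos : b.IsPos γ := isPos_of_natCoeff_pos b e (k := i) (by rw [hγ]; split_ifs <;> omega)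
  have huγ : b.IsPos ((refl P (e i) * specialCoxeter b e) • γ) :=
    isPos_of_natCoeff_pos b e (k := i) (by rw [hs]; split_ifs <;> omega)
  have hle : RootLE b γ ((refl P (e i) * specialCoxeter b e) • γ) := by
    rw [rootLE_iff_natCoeff_le b e]
    intro k
    rw [hγ, hs]
    split_ifs <;> omega
  exact hrat.not_rootLE hγpos hγpos huγ huγ hle hle

theorem IsTypeANumbering.ncard_neighborSet (he : IsTypeANumbering b e) (hr : 2 ≤ r)
    (hc : IsRational b (specialCoxeter b e)) :
    ((rationalityGraph b).neighborSet ⟨specialCoxeter b e, hc⟩).ncard = 1 := by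
  rw [Set.ncard_eq_one]
  refine ⟨⟨_, he.isRational_refl_last_mul hr⟩, Set.ext fun v => ?_⟩
  rw [SimpleGraph.mem_neighborSet, Set.mem_singleton_iff]
  constructor
  · rintro ⟨i, hi, h⟩
    obtain ⟨k, hk⟩ := e.surjective ⟨i, hi⟩
    have hv : (v : P.weylGroup) = refl P (e k) * specialCoxeter b e := by
      rw [hk]
      change specialCoxeter b e = _ at h
      rw [h, ← mul_assoc, refl_mul_self, one_mul]
    have hkr : (k : ℕ) = r - 1 := by
      by_contra hne
      exact he.not_isRational_refl_mul k hne (hv ▸ v.2)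
    have hk' : k = ⟨r - 1, by omega⟩ := Fin.ext hkr
    exact Subtype.ext (hk' ▸ hv : (v : P.weylGroup) = refl P (e ⟨r - 1, _⟩) * _)
  · rintro rfl
    refine ⟨e ⟨r - 1, by omega⟩, (e _).2, ?_⟩
    change specialCoxeter b e = _
    rw [← mul_assoc, refl_mul_self, one_mul]

end TypeA

end RatWeyl

theorem propositionp {ι K M N : Type*} [Finite ι] [Field K] [CharZero K]
    [AddCommGroup M] [Module K M] [AddCommGroup N] [Module K N]
    (P : RootPairing ι K M N) [P.IsRootSystem] [P.IsCrystallographic] [P.IsReduced]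
    [P.IsIrreducible] (b : P.Base) (c : P.weylGroup) (hc : RatWeyl.IsCoxeterElement b c) :
    (RatWeyl.IsRational b c ↔
      ∃ r : ℕ, 1 ≤ r ∧ ∃ e : Fin r ≃ b.support, RatWeyl.IsTypeANumbering b e ∧
        (c = RatWeyl.specialCoxeter b e ∨ c = (RatWeyl.specialCoxeter b e)⁻¹)) ∧
    (∀ hr : RatWeyl.IsRational b c, 2 ≤ b.support.card →
      ((RatWeyl.rationalityGraph b).neighborSet ⟨c, hr⟩).ncard = 1) := by
  obtain ⟨r, e, rfl⟩ := hc.exists_eq_specialCoxeter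
  have hcard : b.support.card = r := by
    simpa using (Fintype.card_congr e).symm
  obtain ⟨n, rfl⟩ : ∃ n, r = n + 1 := by
    have : Nonempty ι := by
      by_contra! h
      have := RootPairing.IsIrreducible.nontrivial P
      have hspan := RootPairing.IsRootSystem.span_root_eq_top (P := P)
      simp [Set.range_eq_empty] at hspan
    have := b.support_nonempty.card_pos
    exact ⟨r - 1, by omega⟩
  refine ⟨⟨fun h => ⟨n + 1, by omega, e, h.isTypeANumbering b e, Or.inl rfl⟩, ?_⟩,
    fun h h2 => (h.isTypeANumbering b e).ncard_neighborSet (hcard ▸ h2) h⟩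
  rintro ⟨s, -, e', he', h | h⟩
  · exact h ▸ he'.isRational_specialCoxeter
  · rw [h, RatWeyl.specialCoxeter_inv]
    exact he'.rev.isRational_specialCoxeter
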